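/- Let $k, m, M$ be natural numbers with $M \ge 2$. There are constants $c_7, c_8$, depending only on $k, M, m$, such that the following holds. Let $Z = (Z^{(1)},\dots,Z^{(k)})$ be a random vector in $\mathbb{R}^k$ with independent standard normal coordinates, and let $$f(x) = \sum_{m_1=0}^m \cdots \sum_{m_k=0}^m \alpha(m_1,\dots,m_k)\, x_1^{m_1}\cdots x_k^{m_k}$$ be a polynomial with real coefficients and $\alpha(0,\dots,0)=0$, whose degree $\max\{m_1+\cdots+m_k : \alpha(m_1,\dots,m_k)\neq 0\}$ equals $M$. Put $$\alpha_* = \max\{|\alpha(m_1,\dots,m_k)| : 0\le m_1,\dots,m_k\le m,\ m_1+\cdots+m_k=M\} > 0.$$ Then for every real $t\neq 0$ $$\sup_{a\in\mathbb{R}^k} \bigl|\mathbf{E}\exp\{itf(Z+a)\}\bigr| \le c_7\,|\alpha_* t|^{-1/m}\,\ln^{c_8}(2+|\alpha_* t|).$$ -/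

import Mathlib

open MeasureTheory ProbabilityTheory
open scoped NNReal

/-- The largest absolute value of a coefficient of `f` among the monomials whose total degree is
the total degree of `f`. (Monomials outside the support have coefficient `0`, so restricting the
maximum to the support does not change it.) -/
noncomputable def maxTopCoeff {k : ℕ} (f : MvPolynomial (Fin k) ℝ) : ℝ :=
  (((f.support.filter (fun d => d.degree = f.totalDegree)).sup (fun d => ‖f.coeff d‖₊) : ℝ≥0) : ℝ)

/-- `|E exp {i t f(Z + a)}|` for a random vector `Z = (Z 0, …, Z (k-1))` and `a ∈ ℝ^k`. -/
noncomputable def absCharFun {k : ℕ} {Ω : Type*} [MeasurableSpace Ω] (P : Measure Ω)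
    (Z : Fin k → Ω → ℝ) (f : MvPolynomial (Fin k) ℝ) (t : ℝ) (a : Fin k → ℝ) : ℝ :=
  ‖∫ ω, Complex.exp
      (Complex.I * (t : ℂ) * ((MvPolynomial.eval (fun i => Z i ω + a i) f : ℝ) : ℂ)) ∂P‖

/-! Fix `θ < 1` and pay one factor `A = K / (1 - θ)` per variable.

Negative moments. If `q` has degree at most `n`, any coefficient is at most `2 ^ n` times the Mahler
measure of `q`. Comparing the Mahler measure with `|q x|` root by root bounds `|q x| ^ (-(θ / n))`
by singularities of order `θ`, whose Gaussian integrals are `O(1 / (1 - θ))`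
(`exists_lintegral_eval_rpow_neg_le`).

Oscillation in one variable. For a phase `p` with `q = p'`, split `1 = l² / (q² + l²) + q² / (q² +
l²)`. The first part is controlled by a negative moment of `q`. The second is `O(1 / l)` by parts,
since `arctan (q / l) / l` has total variation `O(1 / l)` depending only on the degree. Balancing
`l` gives decay of order `θ / m` in any nonconstant coefficient
(`exists_enorm_integral_exp_eval_le`).

Several variables. In `enorm_integral_pi_exp_eval_le`, oscillation is used in one variable occurring
in the chosen monomial, and negative moments in all the others, giving `A ^ k`. Shifts preserve
coefficients of top degree, hence uniformity in `a`. Taking `1 - θ` of order `1 / log (2 + s)`, with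
`s = |α_* t|`, turns `A ^ k` into a power of a logarithm and costs only a factor 2 in `s ^ (-1 /
m)`. -/

/-! ### Gaussian integrals of power singularities -/

lemma lintegral_indicator_rpow_neg {θ : ℝ} (h1 : θ < 1) :
    ∫⁻ x, (Set.Ioc (0 : ℝ) 1).indicator (fun x => ENNReal.ofReal (x ^ (-θ))) x
      = ENNReal.ofReal (1 / (1 - θ)) := by
  rw [lintegral_indicator measurableSet_Ioc, ← ofReal_integral_eq_lintegral_ofReal]
  · rw [← intervalIntegral.integral_of_le zero_le_one, integral_rpow (Or.inl (by linarith))]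
    rw [Real.one_rpow, Real.zero_rpow (by linarith)]
    congr 1
    ring
  · exact (intervalIntegral.intervalIntegrable_rpow' (by linarith)).1
  · filter_upwards [ae_restrict_mem measurableSet_Ioc] with x hx
    exact Real.rpow_nonneg hx.1.le _

/-- A weight with a singularity of order `θ < 1` has a Gaussian integral of order `1 / (1 - θ)`,
uniformly in the position of the singularity. -/
lemma exists_lintegral_singular_weight_le :
    ∃ K : ℝ, 1 ≤ K ∧ ∀ θ : ℝ, 0 < θ → θ < 1 → ∀ r : ℝ,
      ∫⁻ x, ENNReal.ofReal (((1 + |x|) / |x - r|) ^ θ) ∂(gaussianReal 0 1)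
        ≤ ENNReal.ofReal (K / (1 - θ)) := by
  have hint : Integrable (fun x : ℝ => 1 + |x|) (gaussianReal 0 1) :=
    (integrable_const 1).add ((memLp_id_gaussianReal 1).integrable le_rfl).abs
  set A : ℝ := ∫ x, (1 + |x|) ∂(gaussianReal 0 1) with hA
  have hA1 : 0 ≤ A := integral_nonneg fun x => by positivity
  -- `A` pays for `|x - r| ≥ 1`. The 4 pays for the two sides of `r`: the density times `1 + |x|` is
  -- at most 2, and `x ^ (-θ)` integrates to `1 / (1 - θ)` on each side.
  refine ⟨A + 4, by linarith, fun θ h0 h1 r => ?_⟩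
  have h1' : 0 < 1 - θ := by linarith
  set G : ℝ → ENNReal := (Set.Ioc (0 : ℝ) 1).indicator (fun x => ENNReal.ofReal (x ^ (-θ)))
    with hG
  have hGm : Measurable G := by
    refine Measurable.indicator ?_ measurableSet_Ioc
    fun_prop
  have hφ : ∀ x : ℝ, gaussianPDFReal 0 1 x * (1 + |x|) ≤ 2 := by
    intro x
    have e1 : gaussianPDFReal 0 1 x ≤ Real.exp (-(x ^ 2 / 2)) := by
      rw [gaussianPDFReal]
      have : (√(2 * Real.pi * ((1 : ℝ≥0) : ℝ)))⁻¹ ≤ 1 := by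
        apply inv_le_one_of_one_le₀
        rw [Real.one_le_sqrt]
        have := Real.pi_gt_three
        simp; linarith
      calc _ ≤ 1 * Real.exp (-(x - 0) ^ 2 / (2 * ((1 : ℝ≥0) : ℝ))) := by gcongr
        _ = _ := by simp [neg_div]
    have e2 : 1 + |x| ≤ 2 * Real.exp (x ^ 2 / 2) := by
      have := Real.add_one_le_exp (x ^ 2 / 2)
      nlinarith [sq_nonneg (|x| - 1), sq_abs x]
    calc _ ≤ Real.exp (-(x ^ 2 / 2)) * (2 * Real.exp (x ^ 2 / 2)) := by gcongr
      _ = 2 * (Real.exp (-(x ^ 2 / 2)) * Real.exp (x ^ 2 / 2)) := by ring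
      _ = 2 := by rw [← Real.exp_add]; simp
  have key : ∀ x : ℝ, gaussianPDF 0 1 x * ENNReal.ofReal (((1 + |x|) / |x - r|) ^ θ) ≤
      gaussianPDF 0 1 x * ENNReal.ofReal (1 + |x|) + (2 * G (x - r) + 2 * G (r - x)) := by
    intro x
    have hx1 : (1 + |x|) ^ θ ≤ 1 + |x| :=
      (Real.rpow_le_rpow_of_exponent_le (by linarith [abs_nonneg x]) h1.le).trans_eq
        (Real.rpow_one _)
    rw [Real.div_rpow (by positivity) (abs_nonneg _), div_eq_mul_inv,
      ← Real.rpow_neg (abs_nonneg _)]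
    rcases le_or_gt 1 |x - r| with h | h
    · refine le_trans ?_ le_self_add
      gcongr
      calc (1 + |x|) ^ θ * |x - r| ^ (-θ) ≤ (1 + |x|) * 1 := by
            gcongr
            exact Real.rpow_le_one_of_one_le_of_nonpos h (by linarith)
        _ = _ := mul_one _
    · refine le_trans ?_ le_add_self
      have : gaussianPDF 0 1 x * ENNReal.ofReal ((1 + |x|) ^ θ * |x - r| ^ (-θ)) ≤
          2 * ENNReal.ofReal (|x - r| ^ (-θ)) := by
        rw [gaussianPDF, ← ENNReal.ofReal_mul (gaussianPDFReal_nonneg _ _ _),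
          show (2 : ENNReal) = ENNReal.ofReal 2 by simp, ← ENNReal.ofReal_mul (by norm_num)]
        apply ENNReal.ofReal_le_ofReal
        rw [← mul_assoc]
        gcongr
        refine le_trans ?_ (hφ x)
        have := gaussianPDFReal_nonneg 0 1 x
        gcongr
      refine this.trans ?_
      rcases lt_trichotomy (x - r) 0 with hn | hn | hn
      · refine le_trans ?_ le_add_self
        rw [abs_of_neg hn] at h ⊢
        rw [hG, Set.indicator_of_mem (by constructor <;> linarith), neg_sub]
      -- At `x = r` the real power `0 ^ (-θ)` is 0 by convention.
      · rw [hn, abs_zero, Real.zero_rpow (by linarith)]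
        simp
      · refine le_trans ?_ le_self_add
        rw [abs_of_pos hn] at h ⊢
        rw [hG, Set.indicator_of_mem (by constructor <;> linarith)]
  rw [gaussianReal_of_var_ne_zero _ one_ne_zero,
    lintegral_withDensity_eq_lintegral_mul _ (measurable_gaussianPDF _ _) (by fun_prop)]
  refine (lintegral_mono key).trans ?_
  have hA2 : ∫⁻ x, gaussianPDF 0 1 x * ENNReal.ofReal (1 + |x|) = ENNReal.ofReal A := by
    rw [hA, ofReal_integral_eq_lintegral_ofReal hint (ae_of_all _ fun x => by positivity),
      gaussianReal_of_var_ne_zero _ one_ne_zero,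
      lintegral_withDensity_eq_lintegral_mul _ (measurable_gaussianPDF _ _) (by fun_prop)]
    rfl
  have hm : Measurable fun x : ℝ => gaussianPDF 0 1 x * ENNReal.ofReal (1 + |x|) :=
    (measurable_gaussianPDF _ _).mul (by fun_prop)
  rw [lintegral_add_left hm,
    lintegral_add_left (by fun_prop), lintegral_const_mul _ (by fun_prop),
    lintegral_const_mul _ (by fun_prop), lintegral_sub_right_eq_self G r,
    lintegral_sub_left_eq_self G r, lintegral_indicator_rpow_neg h1, hA2,
    show (2 : ENNReal) = ENNReal.ofReal 2 by simp, ← ENNReal.ofReal_mul (by norm_num),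
    ← ENNReal.ofReal_add (by positivity) (by positivity),
    ← ENNReal.ofReal_add (by positivity) (by positivity)]
  apply ENNReal.ofReal_le_ofReal
  rw [add_div]
  have : A ≤ A / (1 - θ) := by
    rw [le_div_iff₀ h1']
    nlinarith
  have e : 4 / (1 - θ) = 2 * (1 / (1 - θ)) + 2 * (1 / (1 - θ)) := by ring
  linarith

/-! ### Coefficients and negative moments in one variable -/

lemma multiset_prod_map_le_pow_card {ι : Type*} (s : Multiset ι) (f : ι → ℝ) (B : ℝ)
    (h0 : ∀ i ∈ s, 0 ≤ f i) (h : ∀ i ∈ s, f i ≤ B) : (s.map f).prod ≤ B ^ s.card := by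
  induction s using Multiset.induction_on with
  | empty => simp
  | cons a s ih =>
    rw [Multiset.map_cons, Multiset.prod_cons, Multiset.card_cons, pow_succ']
    have ha := h0 a (Multiset.mem_cons_self a s)
    have hb := h a (Multiset.mem_cons_self a s)
    refine mul_le_mul hb (ih (fun i hi => h0 i (Multiset.mem_cons_of_mem hi))
      (fun i hi => h i (Multiset.mem_cons_of_mem hi))) ?_ (ha.trans hb)
    apply Multiset.prod_nonneg
    intro y hy
    obtain ⟨i, hi, rfl⟩ := Multiset.mem_map.1 hy
    exact h0 i (Multiset.mem_cons_of_mem hi)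

/-- Each coefficient of a polynomial is controlled by its value at a point, in terms of the
distances to the real parts of the roots. -/
lemma exists_abs_coeff_le_eval (q : Polynomial ℝ) (n j : ℕ) (hq : q.natDegree ≤ n) :
    ∃ R : Finset ℝ, R.card ≤ n ∧ ∀ x ∉ R,
      |q.coeff j| ≤ 2 ^ n * (|q.eval x| * (1 + ∑ r ∈ R, (1 + |x|) / |x - r|) ^ n) := by
  set Q : Polynomial ℂ := q.map (algebraMap ℝ ℂ) with hQ
  have hdeg : Q.natDegree = q.natDegree := Polynomial.natDegree_map _
  have hsplit : Q.Splits := IsAlgClosed.splits Q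
  have hcard : Q.roots.card ≤ n := (Polynomial.card_roots' Q).trans (hdeg.le.trans hq)
  refine ⟨(Q.roots.map Complex.re).toFinset,
    (Multiset.toFinset_card_le _).trans (by simpa using hcard), fun x hx => ?_⟩
  set S := ∑ r ∈ (Q.roots.map Complex.re).toFinset, (1 + |x|) / |x - r| with hS
  have hS0 : 0 ≤ S := Finset.sum_nonneg fun _ _ => by positivity
  have hne : ∀ z ∈ Q.roots, 0 < |x - z.re| := by
    intro z hz
    rw [abs_pos, sub_ne_zero]
    rintro rfl
    exact hx (Multiset.mem_toFinset.2 (Multiset.mem_map.2 ⟨z, hz, rfl⟩))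
  have h1 : |q.coeff j| ≤ 2 ^ n * Q.mahlerMeasure := by
    have := Polynomial.norm_coeff_le_choose_mul_mahlerMeasure j Q
    rw [hQ, Polynomial.coeff_map] at this
    simp only [Complex.coe_algebraMap, Complex.norm_real, Real.norm_eq_abs] at this
    refine this.trans ?_
    have h2 : ((Q.natDegree.choose j : ℕ) : ℝ) ≤ 2 ^ n := by
      calc ((Q.natDegree.choose j : ℕ) : ℝ) ≤ ((2 ^ Q.natDegree : ℕ) : ℝ) := by
            exact_mod_cast Nat.choose_le_two_pow _ _
        _ ≤ 2 ^ n := by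
          push_cast
          exact pow_le_pow_right₀ (by norm_num) (hdeg.le.trans hq)
    exact mul_le_mul_of_nonneg_right h2 (Polynomial.mahlerMeasure_nonneg _)
  refine h1.trans ?_
  gcongr
  have hev : |q.eval x| = ‖Q.leadingCoeff‖ * (Q.roots.map fun z => ‖(x : ℂ) - z‖).prod := by
    have : Q.eval (x : ℂ) = ((q.eval x : ℝ) : ℂ) := by
      rw [hQ, Polynomial.eval_map_algebraMap]
      simpa using Polynomial.aeval_algebraMap_apply ℂ x q
    have h3 := congrArg norm this
    rw [hsplit.eval_eq_prod_roots, norm_mul, Complex.norm_real, Real.norm_eq_abs] at h3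
    rw [← h3]
    congr 1
    have h4 := map_multiset_prod (normHom : ℂ →*₀ ℝ) (Q.roots.map fun z => (x : ℂ) - z)
    rw [Multiset.map_map] at h4
    exact h4
  rw [Polynomial.mahlerMeasure_eq_leadingCoeff_mul_prod_roots, hev, mul_assoc]
  gcongr
  -- Root by root, the Mahler factor `max 1 ‖z‖` is compared with `‖x - z‖`, using `‖z‖ ≤ ‖x - z‖ +
  -- |x|` and `|x - Re z| ≤ ‖x - z‖`.
  have hb : ∀ z ∈ Q.roots, max 1 ‖z‖ ≤ ‖(x : ℂ) - z‖ * (1 + (1 + |x|) / |x - z.re|) := by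
    intro z hz
    have hz0 := hne z hz
    have e1 : |x - z.re| ≤ ‖(x : ℂ) - z‖ := by
      simpa using Complex.abs_re_le_norm ((x : ℂ) - z)
    have e2 : ‖z‖ ≤ ‖(x : ℂ) - z‖ + |x| := by
      have := norm_sub_norm_le z x
      rw [norm_sub_rev, Complex.norm_real, Real.norm_eq_abs] at this
      linarith
    have e3 : 1 + |x| ≤ ‖(x : ℂ) - z‖ * ((1 + |x|) / |x - z.re|) := by
      rw [mul_div_assoc', le_div_iff₀ hz0, mul_comm]
      gcongr
    rw [mul_add, mul_one]
    exact max_le (by linarith [abs_nonneg x, norm_nonneg ((x : ℂ) - z)]) (by linarith)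
  calc (Q.roots.map fun z => max 1 ‖z‖).prod
      ≤ (Q.roots.map fun z => ‖(x : ℂ) - z‖ * (1 + (1 + |x|) / |x - z.re|)).prod :=
        Multiset.prod_map_le_prod_map₀ _ _ (fun z _ => by positivity) hb
    _ = (Q.roots.map fun z => ‖(x : ℂ) - z‖).prod *
          (Q.roots.map fun z => (1 + (1 + |x|) / |x - z.re|)).prod := Multiset.prod_map_mul
    _ ≤ (Q.roots.map fun z => ‖(x : ℂ) - z‖).prod * (1 + S) ^ n := by
        have h0 : 0 ≤ (Q.roots.map fun z => ‖(x : ℂ) - z‖).prod := by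
          apply Multiset.prod_nonneg
          intro y hy
          obtain ⟨z, -, rfl⟩ := Multiset.mem_map.1 hy
          positivity
        gcongr
        refine (multiset_prod_map_le_pow_card _ _ (1 + S) (fun z _ => by positivity)
          fun z hz => ?_).trans (pow_le_pow_right₀ (by linarith) hcard)
        gcongr
        exact Finset.single_le_sum (f := fun r => (1 + |x|) / |x - r|)
          (fun _ _ => by positivity)
          (Multiset.mem_toFinset.2 (Multiset.mem_map.2 ⟨z, hz, rfl⟩))

lemma one_add_sum_rpow_le {ι : Type*} (s : Finset ι) (w : ι → ℝ) (hw : ∀ i, 0 ≤ w i) {θ : ℝ}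
    (h0 : 0 ≤ θ) (h1 : θ ≤ 1) : (1 + ∑ i ∈ s, w i) ^ θ ≤ 1 + ∑ i ∈ s, w i ^ θ := by
  classical
  induction s using Finset.induction_on with
  | empty => simp
  | insert a s ha ih =>
    rw [Finset.sum_insert ha, Finset.sum_insert ha, add_left_comm, add_left_comm 1]
    exact (Real.rpow_add_le_add_rpow (hw a)
      (by linarith [Finset.sum_nonneg fun i (_ : i ∈ s) => hw i]) h0 h1).trans (by gcongr)

/-- Negative moments of a polynomial in one Gaussian variable. -/
lemma exists_lintegral_eval_rpow_neg_le (n : ℕ) (hn : n ≠ 0) :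
    ∃ K : ℝ, 1 ≤ K ∧ ∀ θ : ℝ, 0 < θ → θ < 1 → ∀ (q : Polynomial ℝ) (j : ℕ), q.natDegree ≤ n →
      ∫⁻ x, ‖q.eval x‖ₑ ^ (-(θ / n)) ∂(gaussianReal 0 1)
        ≤ ENNReal.ofReal (K / (1 - θ)) * ‖q.coeff j‖ₑ ^ (-(θ / n)) := by
  obtain ⟨K, hK1, hK⟩ := exists_lintegral_singular_weight_le
  refine ⟨2 * (1 + n * K), by nlinarith [(Nat.cast_nonneg n : (0 : ℝ) ≤ n)], ?_⟩
  intro θ h0 h1 q j hq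
  have h1' : 0 < 1 - θ := by linarith
  have hn' : (0 : ℝ) < n := by positivity
  have hs : 0 < θ / n := by positivity
  -- In `ENNReal` a negative power of 0 is `⊤`, so a vanishing coefficient makes the bound trivial.
  by_cases hc : q.coeff j = 0
  · rw [hc, enorm_zero, ENNReal.zero_rpow_of_neg (by linarith), ENNReal.mul_top]
    · exact le_top
    · simp only [ne_eq, ENNReal.ofReal_eq_zero, not_le]
      positivity
  have hq0 : q ≠ 0 := by rintro rfl; simp at hc
  obtain ⟨R, hR, hb⟩ := exists_abs_coeff_le_eval q n j hq
  have : NullSingletonClass (gaussianReal 0 1) := nullSingletonClass_gaussianReal one_ne_zero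
  -- The real roots of `q` are discarded too, since there the integrand is `⊤`.
  have hae : ∀ᵐ x ∂(gaussianReal 0 1), x ∉ (R ∪ q.roots.toFinset) := by
    rw [ae_iff]
    simp only [not_not]
    exact (R ∪ q.roots.toFinset).measure_zero (gaussianReal 0 1)
  have hpt : ∀ x ∉ (R ∪ q.roots.toFinset), ‖q.eval x‖ₑ ^ (-(θ / n)) ≤
      ‖q.coeff j‖ₑ ^ (-(θ / n)) *
        (2 * (1 + ∑ r ∈ R, ENNReal.ofReal (((1 + |x|) / |x - r|) ^ θ))) := by
    intro x hx
    rw [Finset.notMem_union] at hx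
    have hx0 : q.eval x ≠ 0 := by
      intro h
      exact hx.2 (Multiset.mem_toFinset.2 ((Polynomial.mem_roots hq0).2 h))
    have e := hb x hx.1
    have hS0 : 0 ≤ ∑ r ∈ R, (1 + |x|) / |x - r| := Finset.sum_nonneg fun _ _ => by positivity
    have hS1 : 0 ≤ ∑ r ∈ R, ((1 + |x|) / |x - r|) ^ θ :=
      Finset.sum_nonneg fun _ _ => by positivity
    have e2 : |q.coeff j| ^ (θ / n) ≤
        |q.eval x| ^ (θ / n) * (2 * (1 + ∑ r ∈ R, ((1 + |x|) / |x - r|) ^ θ)) := by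
      have hpow : ∀ y : ℝ, 0 ≤ y → (y ^ n) ^ (θ / n) = y ^ θ := by
        intro y hy
        rw [← Real.rpow_natCast, ← Real.rpow_mul hy]
        congr 1
        field_simp
      calc |q.coeff j| ^ (θ / n) ≤ _ := Real.rpow_le_rpow (abs_nonneg _) e hs.le
        _ = 2 ^ θ * (|q.eval x| ^ (θ / n) * (1 + ∑ r ∈ R, (1 + |x|) / |x - r|) ^ θ) := by
          rw [Real.mul_rpow (by positivity) (by positivity),
            Real.mul_rpow (by positivity) (by positivity), hpow _ (by norm_num),
            hpow _ (by positivity)]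
        _ ≤ 2 * (|q.eval x| ^ (θ / n) * (1 + ∑ r ∈ R, ((1 + |x|) / |x - r|) ^ θ)) := by
          gcongr
          · exact (Real.rpow_le_rpow_of_exponent_le (by norm_num) h1.le).trans_eq
              (Real.rpow_one _)
          · exact one_add_sum_rpow_le R _ (fun r => by positivity) h0.le h1.le
        _ = _ := by ring
    have e3 : |q.eval x| ^ (-(θ / n)) ≤
        |q.coeff j| ^ (-(θ / n)) * (2 * (1 + ∑ r ∈ R, ((1 + |x|) / |x - r|) ^ θ)) := by
      have p1 : 0 < |q.coeff j| ^ (θ / n) := Real.rpow_pos_of_pos (abs_pos.2 hc) _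
      have p2 : 0 < |q.eval x| ^ (θ / n) := Real.rpow_pos_of_pos (abs_pos.2 hx0) _
      rw [Real.rpow_neg (abs_nonneg _), Real.rpow_neg (abs_nonneg _), inv_mul_eq_div,
        le_div_iff₀ p1, inv_mul_le_iff₀ p2]
      exact e2
    have e4 := ENNReal.ofReal_le_ofReal e3
    rw [ENNReal.ofReal_mul (by positivity), ENNReal.ofReal_mul (by norm_num),
      ENNReal.ofReal_add (by norm_num) hS1, ENNReal.ofReal_sum_of_nonneg
        (fun _ _ => by positivity), ← ENNReal.ofReal_rpow_of_pos (abs_pos.2 hx0),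
      ← ENNReal.ofReal_rpow_of_pos (abs_pos.2 hc)] at e4
    rw [Real.enorm_eq_ofReal_abs, Real.enorm_eq_ofReal_abs]
    simpa using e4
  calc ∫⁻ x, ‖q.eval x‖ₑ ^ (-(θ / n)) ∂(gaussianReal 0 1)
      ≤ ∫⁻ x, ‖q.coeff j‖ₑ ^ (-(θ / n)) *
        (2 * (1 + ∑ r ∈ R, ENNReal.ofReal (((1 + |x|) / |x - r|) ^ θ))) ∂(gaussianReal 0 1) :=
        lintegral_mono_ae (hae.mono hpt)
    _ = ‖q.coeff j‖ₑ ^ (-(θ / n)) * (2 * (1 + ∑ r ∈ R,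
          ∫⁻ x, ENNReal.ofReal (((1 + |x|) / |x - r|) ^ θ) ∂(gaussianReal 0 1))) := by
        rw [lintegral_const_mul _ (by fun_prop), lintegral_const_mul _ (by fun_prop),
          lintegral_add_left (by fun_prop), lintegral_finsetSum _ (fun _ _ => by fun_prop)]
        simp
    _ ≤ ‖q.coeff j‖ₑ ^ (-(θ / n)) * (2 * (1 + ∑ r ∈ R, ENNReal.ofReal (K / (1 - θ)))) := by
        gcongr with r hr
        exact hK θ h0 h1 r
    _ ≤ ‖q.coeff j‖ₑ ^ (-(θ / n)) * ENNReal.ofReal (2 * (1 + n * K) / (1 - θ)) := by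
        gcongr
        rw [Finset.sum_const, nsmul_eq_mul, show (2 : ENNReal) = ENNReal.ofReal 2 by simp,
          ← ENNReal.ofReal_one, ← ENNReal.ofReal_natCast, ← ENNReal.ofReal_mul (by positivity),
          ← ENNReal.ofReal_add (by norm_num) (by positivity), ← ENNReal.ofReal_mul (by norm_num)]
        apply ENNReal.ofReal_le_ofReal
        rw [mul_div_assoc, add_div]
        gcongr
        · rw [le_div_iff₀ h1']; linarith
        · rw [← mul_div_assoc]
          gcongr
    _ = _ := mul_comm _ _

/-! ### Bounded variation and integration by parts -/

/-- A bounded `C¹` function whose derivative has finitely many zeros has bounded variation. -/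
lemma intervalIntegral_abs_deriv_le {F F' : ℝ → ℝ} (hF : ∀ x, HasDerivAt F (F' x) x)
    (hF' : Continuous F') {C : ℝ} (hC : ∀ x, |F x| ≤ C) (S : Finset ℝ)
    (hS : ∀ x, F' x = 0 → x ∈ S) {a b : ℝ} (hab : a ≤ b) :
    ∫ x in a..b, |F' x| ≤ (S.card + 1) * (2 * C) := by
  have hC0 : 0 ≤ C := (abs_nonneg _).trans (hC 0)
  -- Induction on the number of points of `S` inside the interval: cut at a zero of `F'`. Without an
  -- interior zero `F'` has constant sign by Darboux, and the integral is `|F b - F a| ≤ 2 * C`.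
  suffices h : ∀ n : ℕ, ∀ a b : ℝ, a ≤ b → (S.filter (· ∈ Set.Ioo a b)).card = n →
      ∫ x in a..b, |F' x| ≤ (n + 1) * (2 * C) by
    refine (h _ a b hab rfl).trans ?_
    gcongr
    exact Finset.filter_subset _ _
  intro n
  induction n using Nat.strong_induction_on with
  | _ n ih =>
    intro a b hab hn
    by_cases hz : ∃ s ∈ Set.Ioo a b, F' s = 0
    · obtain ⟨s, hs, hs0⟩ := hz
      have hsS : s ∈ S.filter (· ∈ Set.Ioo a b) := Finset.mem_filter.2 ⟨hS s hs0, hs⟩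
      have hdisj : Disjoint (S.filter (· ∈ Set.Ioo a s)) (S.filter (· ∈ Set.Ioo s b)) := by
        rw [Finset.disjoint_left]
        intro x hx hx'
        have h1 := (Finset.mem_filter.1 hx).2.2
        have h2 := (Finset.mem_filter.1 hx').2.1
        linarith
      have hsub : S.filter (· ∈ Set.Ioo a s) ∪ S.filter (· ∈ Set.Ioo s b) ⊆
          (S.filter (· ∈ Set.Ioo a b)).erase s := by
        intro x hx
        rw [Finset.mem_erase, Finset.mem_filter]
        rcases Finset.mem_union.1 hx with hx | hx <;>
          obtain ⟨hxS, h1, h2⟩ := Finset.mem_filter.1 hx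
        · exact ⟨h2.ne, hxS, h1, h2.trans hs.2⟩
        · exact ⟨h1.ne', hxS, hs.1.trans h1, h2⟩
      have hcard := Finset.card_le_card hsub
      rw [Finset.card_union_of_disjoint hdisj, Finset.card_erase_of_mem hsS, hn] at hcard
      have hpos : 0 < n := hn ▸ Finset.card_pos.2 ⟨s, hsS⟩
      have i1 := ih _ (by omega) a s hs.1.le rfl
      have i2 := ih _ (by omega) s b hs.2.le rfl
      rw [← intervalIntegral.integral_add_adjacent_intervals
        (hF'.abs.intervalIntegrable a s) (hF'.abs.intervalIntegrable s b)]
      -- The cut point lies in neither open half, so the two counts sum to at most `n - 1`, which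
      -- absorbs the extra `+ 1`.
      have hle : ((S.filter (· ∈ Set.Ioo a s)).card : ℝ) +
          ((S.filter (· ∈ Set.Ioo s b)).card : ℝ) + 1 ≤ n := by
        exact_mod_cast (by omega : _ + _ + 1 ≤ n)
      nlinarith
    · have hne : ∀ x ∈ Set.Ioo a b, F' x ≠ 0 := fun x hx h0 => hz ⟨x, hx, h0⟩
      have hint : ∫ x in a..b, F' x = F b - F a :=
        intervalIntegral.integral_eq_sub_of_hasDerivAt (fun x _ => hF x)
          (hF'.intervalIntegrable a b)
      have hFb := abs_le.1 (hC b)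
      have hFa := abs_le.1 (hC a)
      have hn0 : (0 : ℝ) ≤ n := Nat.cast_nonneg n
      have hfin : ∫ x in a..b, |F' x| ≤ 2 * C := by
        rcases hasDerivWithinAt_forall_lt_or_forall_gt_of_forall_ne (convex_Ioo a b)
          (fun x _ => (hF x).hasDerivWithinAt) hne with h | h
        · have : ∫ x in a..b, |F' x| = ∫ x in a..b, -F' x := by
            rw [intervalIntegral.integral_of_le hab, intervalIntegral.integral_of_le hab,
              integral_Ioc_eq_integral_Ioo, integral_Ioc_eq_integral_Ioo]
            exact setIntegral_congr_fun measurableSet_Ioo fun x hx => abs_of_neg (h x hx)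
          rw [this, intervalIntegral.integral_neg, hint]
          linarith
        · have : ∫ x in a..b, |F' x| = ∫ x in a..b, F' x := by
            rw [intervalIntegral.integral_of_le hab, intervalIntegral.integral_of_le hab,
              integral_Ioc_eq_integral_Ioo, integral_Ioc_eq_integral_Ioo]
            exact setIntegral_congr_fun measurableSet_Ioo fun x hx => abs_of_pos (h x hx)
          rw [this, hint]
          linarith
      nlinarith

lemma integrable_of_intervalIntegral_abs_le {f : ℝ → ℝ} (hf : Continuous f) {I : ℝ}
    (h : ∀ a b, a ≤ b → ∫ x in a..b, |f x| ≤ I) :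
    Integrable f ∧ ∫ x, |f x| ≤ I := by
  have hi : Integrable f := by
    refine integrable_of_intervalIntegral_norm_bounded (l := Filter.atTop)
      (a := fun i : ℝ => -i) (b := fun i : ℝ => i) I (fun i => ?_)
      Filter.tendsto_neg_atTop_atBot Filter.tendsto_id ?_
    · exact hf.integrableOn_Ioc
    · filter_upwards [Filter.eventually_ge_atTop (0 : ℝ)] with i hi
      simpa only [Real.norm_eq_abs] using h (-i) i (by linarith)
  refine ⟨hi, ?_⟩
  refine le_of_tendsto (intervalIntegral_tendsto_integral hi.abs
    Filter.tendsto_neg_atTop_atBot Filter.tendsto_id) ?_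
  filter_upwards [Filter.eventually_ge_atTop (0 : ℝ)] with i hi
  exact h (-i) i (by linarith)

/-- The integrand is the derivative of `arctan (q / l) / l`, which is bounded by `π / (2 * l)`, and
it vanishes only at the roots of `q'`. -/
lemma integral_abs_deriv_div_sq_add_sq_le (q : Polynomial ℝ) {l : ℝ} (hl : 0 < l) :
    Integrable (fun x => q.derivative.eval x / (q.eval x ^ 2 + l ^ 2)) ∧
    ∫ x, |q.derivative.eval x / (q.eval x ^ 2 + l ^ 2)| ≤ (q.natDegree + 1) * Real.pi / l := by
  have hpos : ∀ x, 0 < q.eval x ^ 2 + l ^ 2 := fun x => by positivity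
  have hcont : Continuous fun x => q.derivative.eval x / (q.eval x ^ 2 + l ^ 2) :=
    (Polynomial.continuous _).div₀ (((Polynomial.continuous _).pow 2).add continuous_const)
      fun x => (hpos x).ne'
  refine integrable_of_intervalIntegral_abs_le hcont fun a b hab => ?_
  by_cases hq : q.derivative = 0
  · simp only [hq, Polynomial.eval_zero, zero_div, abs_zero, intervalIntegral.integral_zero]
    have := Real.pi_pos
    positivity
  have hd : ∀ x, HasDerivAt (fun x => Real.arctan (q.eval x / l) / l)
      (q.derivative.eval x / (q.eval x ^ 2 + l ^ 2)) x := by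
    intro x
    convert! (((q.hasDerivAt x).div_const l).arctan).div_const l using 1
    have := (hpos x).ne'
    field_simp
    ring
  refine (intervalIntegral_abs_deriv_le hd hcont (C := Real.pi / 2 / l) (fun x => ?_)
    q.derivative.roots.toFinset (fun x hx => ?_) hab).trans ?_
  · rw [abs_div, abs_of_pos hl]
    gcongr
    exact abs_le.2 ⟨(Real.neg_pi_div_two_lt_arctan _).le, (Real.arctan_lt_pi_div_two _).le⟩
  · rw [Multiset.mem_toFinset, Polynomial.mem_roots hq]
    rcases div_eq_zero_iff.1 hx with h | h
    · exact h
    · exact absurd h (hpos x).ne'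
  · have hc : (q.derivative.roots.toFinset.card : ℝ) ≤ q.natDegree := by
      exact_mod_cast (Multiset.toFinset_card_le _).trans ((Polynomial.card_roots' _).trans
        ((Polynomial.natDegree_derivative_le q).trans (Nat.sub_le _ _)))
    have hp := Real.pi_pos
    have e : 2 * (Real.pi / 2 / l) = Real.pi / l := by ring
    rw [e, mul_div_assoc]
    gcongr

lemma gaussianPDFReal_zero_one (x : ℝ) :
    gaussianPDFReal 0 1 x = (√(2 * Real.pi))⁻¹ * Real.exp (-(1 / 2) * x ^ 2) := by
  rw [gaussianPDFReal]
  simp only [NNReal.coe_one, mul_one, sub_zero]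
  congr 2
  ring

lemma gaussianPDFReal_zero_one_le_one (x : ℝ) : gaussianPDFReal 0 1 x ≤ 1 := by
  rw [gaussianPDFReal_zero_one]
  refine mul_le_one₀ (inv_le_one_of_one_le₀ ?_) (Real.exp_nonneg _) (Real.exp_le_one_iff.2 ?_)
  · rw [Real.one_le_sqrt]
    linarith [Real.pi_gt_three]
  · nlinarith [sq_nonneg x]

lemma hasDerivAt_gaussianPDFReal (x : ℝ) :
    HasDerivAt (gaussianPDFReal 0 1) (-x * gaussianPDFReal 0 1 x) x := by
  have h : gaussianPDFReal 0 1 =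
      fun x => (√(2 * Real.pi))⁻¹ * Real.exp (-(1 / 2) * x ^ 2) :=
    funext gaussianPDFReal_zero_one
  rw [h]
  convert! ((((hasDerivAt_pow 2 x).const_mul (-(1 / 2) : ℝ)).exp).const_mul
    ((√(2 * Real.pi))⁻¹)) using 1
  simp
  ring

lemma continuous_gaussianPDFReal_zero_one : Continuous (gaussianPDFReal 0 1) :=
  continuous_iff_continuousAt.2 fun x => (hasDerivAt_gaussianPDFReal x).continuousAt

lemma integrable_id_mul_gaussianPDFReal :
    Integrable fun x : ℝ => x * gaussianPDFReal 0 1 x := by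
  simp only [gaussianPDFReal_zero_one]
  convert! (integrable_mul_exp_neg_mul_sq (b := 1 / 2) (by norm_num)).const_mul
    ((√(2 * Real.pi))⁻¹) using 2 with x
  ring

lemma norm_exp_I_mul_ofReal (y : ℝ) : ‖Complex.exp (Complex.I * (y : ℂ))‖ = 1 := by
  rw [mul_comm]
  exact Complex.norm_exp_ofReal_mul_I y

/-- Integration by parts: the part of the oscillatory integral on which the derivative of the
phase is not small. -/
lemma exists_norm_integral_large_deriv_le (n : ℕ) :
    ∃ K : ℝ, 0 ≤ K ∧ ∀ p : Polynomial ℝ, p.derivative.natDegree ≤ n → ∀ l : ℝ, 0 < l →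
      ‖∫ x, Complex.exp (Complex.I * ((p.eval x : ℝ) : ℂ)) *
        ((p.derivative.eval x ^ 2 / (p.derivative.eval x ^ 2 + l ^ 2) : ℝ) : ℂ)
          ∂(gaussianReal 0 1)‖ ≤ K / l := by
  set A : ℝ := ∫ x : ℝ, |x * gaussianPDFReal 0 1 x| with hA
  have hA0 : 0 ≤ A := integral_nonneg fun _ => abs_nonneg _
  refine ⟨(n + 1) * Real.pi + A / 2, by have := Real.pi_pos; positivity, ?_⟩
  intro p hp l hl
  set φ := gaussianPDFReal 0 1 with hφ
  have hφ0 : ∀ x, 0 ≤ φ x := gaussianPDFReal_nonneg 0 1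
  have hφ1 : ∀ x, φ x ≤ 1 := gaussianPDFReal_zero_one_le_one
  have hφc : Continuous φ := continuous_gaussianPDFReal_zero_one
  have hφi : Integrable φ := integrable_gaussianPDFReal 0 1
  set q := p.derivative with hq
  have hqc : Continuous fun x => q.eval x := q.continuous
  have hq'c : Continuous fun x => q.derivative.eval x := q.derivative.continuous
  have hpos : ∀ x, 0 < q.eval x ^ 2 + l ^ 2 := fun x => by positivity
  have hne : ∀ x, q.eval x ^ 2 + l ^ 2 ≠ 0 := fun x => (hpos x).ne'
  have hql : ∀ x, |q.eval x / (q.eval x ^ 2 + l ^ 2)| ≤ 1 / (2 * l) := by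
    intro x
    rw [abs_div, abs_of_pos (hpos x), div_le_div_iff₀ (hpos x) (by positivity)]
    nlinarith [sq_nonneg (|q.eval x| - l), sq_abs (q.eval x)]
  set V : ℝ → ℂ := fun x => Complex.exp (Complex.I * ((p.eval x : ℝ) : ℂ)) with hV
  have hVn : ∀ x, ‖V x‖ = 1 := fun x => norm_exp_I_mul_ofReal _
  have hVc : Continuous V := by
    have := p.continuous
    fun_prop
  have hVd : ∀ x, HasDerivAt V (V x * (Complex.I * ((q.eval x : ℝ) : ℂ))) x := fun x =>
    (((p.hasDerivAt x).ofReal_comp).const_mul Complex.I).cexp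
  -- Chosen so that `V' * w = I * V * q² / (q² + l²) * φ`: the target integral is then ready for
  -- integration by parts.
  set w : ℝ → ℝ := fun x => q.eval x / (q.eval x ^ 2 + l ^ 2) * φ x with hw
  set w' : ℝ → ℝ := fun x =>
    (q.derivative.eval x * (q.eval x ^ 2 + l ^ 2) -
      q.eval x * (2 * q.eval x * q.derivative.eval x)) / (q.eval x ^ 2 + l ^ 2) ^ 2 * φ x +
      q.eval x / (q.eval x ^ 2 + l ^ 2) * (-x * φ x) with hw'
  have hwd : ∀ x, HasDerivAt w (w' x) x := by
    intro x
    have h1 : HasDerivAt (fun x => q.eval x ^ 2 + l ^ 2)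
        (2 * q.eval x * q.derivative.eval x) x := by
      convert! ((q.hasDerivAt x).pow 2).add_const (l ^ 2) using 1
      simp
    exact (((q.hasDerivAt x).div h1 (hne x)).mul (hasDerivAt_gaussianPDFReal x))
  have hwc : Continuous w := continuous_iff_continuousAt.2 fun x => (hwd x).continuousAt
  have hw'c : Continuous w' := by
    refine Continuous.add (Continuous.mul (Continuous.div₀ ?_ ?_ ?_) hφc)
      (Continuous.mul (Continuous.div₀ ?_ ?_ hne) ?_)
    · fun_prop
    · fun_prop
    · exact fun x => pow_ne_zero 2 (hne x)
    all_goals fun_prop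
  obtain ⟨hi1, hi2⟩ := integral_abs_deriv_div_sq_add_sq_le q hl
  set B : ℝ → ℝ := fun x => |q.derivative.eval x / (q.eval x ^ 2 + l ^ 2)| +
    1 / (2 * l) * |x * φ x| with hB
  have hBi : Integrable B := hi1.abs.add (integrable_id_mul_gaussianPDFReal.abs.const_mul _)
  -- The derivative of `q / (q² + l²)` is `q' * (l² - q²) / (q² + l²)²`, dominated by `|q'| / (q² +
  -- l²)`.
  have hw'B : ∀ x, |w' x| ≤ B x := by
    intro x
    have e1 : |(q.derivative.eval x * (q.eval x ^ 2 + l ^ 2) -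
        q.eval x * (2 * q.eval x * q.derivative.eval x)) / (q.eval x ^ 2 + l ^ 2) ^ 2| ≤
        |q.derivative.eval x / (q.eval x ^ 2 + l ^ 2)| := by
      have : (q.derivative.eval x * (q.eval x ^ 2 + l ^ 2) -
          q.eval x * (2 * q.eval x * q.derivative.eval x)) / (q.eval x ^ 2 + l ^ 2) ^ 2 =
          q.derivative.eval x / (q.eval x ^ 2 + l ^ 2) *
            ((l ^ 2 - q.eval x ^ 2) / (q.eval x ^ 2 + l ^ 2)) := by
        have := hne x
        field_simp
        ring
      rw [this, abs_mul]
      refine mul_le_of_le_one_right (abs_nonneg _) ?_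
      rw [abs_div, abs_of_pos (hpos x), div_le_one (hpos x), abs_le]
      constructor <;> nlinarith [sq_nonneg l, sq_nonneg (q.eval x)]
    refine (abs_add_le _ _).trans (add_le_add ?_ ?_)
    · rw [abs_mul, abs_of_nonneg (hφ0 x)]
      exact (mul_le_of_le_one_right (abs_nonneg _) (hφ1 x)).trans e1
    · rw [abs_mul, neg_mul, abs_neg]
      gcongr
      exact hql x
  have hw'i : Integrable w' := hBi.mono' hw'c.aestronglyMeasurable (ae_of_all _ hw'B)
  have hwi : Integrable w := by
    refine (hφi.const_mul (1 / (2 * l))).mono' hwc.aestronglyMeasurable (ae_of_all _ fun x => ?_)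
    rw [hw, Real.norm_eq_abs, abs_mul, abs_of_nonneg (hφ0 x)]
    gcongr
    · exact hφ0 x
    · exact hql x
  have hbdd : ∀ g : ℝ → ℝ, Continuous g → Integrable g →
      Integrable fun x => V x * ((g x : ℝ) : ℂ) := by
    intro g hgc hg
    refine hg.abs.mono' (by fun_prop) (ae_of_all _ fun x => ?_)
    rw [norm_mul, hVn, one_mul, Complex.norm_real, Real.norm_eq_abs]
  have hparts := integral_mul_deriv_eq_deriv_mul_of_integrable (u := V)
    (u' := fun x => V x * (Complex.I * ((q.eval x : ℝ) : ℂ)))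
    (v := fun x => ((w x : ℝ) : ℂ)) (v' := fun x => ((w' x : ℝ) : ℂ))
    (fun x _ => hVd x) (fun x _ => (hwd x).ofReal_comp) (hbdd w' hw'c hw'i) ?_
    (hbdd w hwc hwi)
  swap
  · refine hφi.mono' ?_ (ae_of_all _ fun x => ?_)
    · apply Continuous.aestronglyMeasurable
      change Continuous fun x => V x * (Complex.I * ((q.eval x : ℝ) : ℂ)) * ((w x : ℝ) : ℂ)
      fun_prop
    · simp only [Pi.mul_apply, norm_mul, hVn, one_mul, Complex.norm_I, Complex.norm_real,
        Real.norm_eq_abs]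
      rw [← abs_mul, hw]
      have : q.eval x * (q.eval x / (q.eval x ^ 2 + l ^ 2) * φ x) =
          q.eval x ^ 2 / (q.eval x ^ 2 + l ^ 2) * φ x := by ring
      rw [this, abs_of_nonneg (mul_nonneg (by positivity) (hφ0 x))]
      refine mul_le_of_le_one_left (hφ0 x) ?_
      rw [div_le_one (hpos x)]
      nlinarith [sq_nonneg l]
  have hrew : ∫ x, V x * ((q.eval x ^ 2 / (q.eval x ^ 2 + l ^ 2) : ℝ) : ℂ) ∂(gaussianReal 0 1) =
      Complex.I * ∫ x, V x * ((w' x : ℝ) : ℂ) := by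
    rw [hparts, integral_gaussianReal_eq_integral_smul one_ne_zero, mul_neg,
      ← integral_const_mul, ← integral_neg]
    congr 1 with x
    rw [hw, Complex.real_smul]
    push_cast
    have hI := Complex.I_sq
    linear_combination (V x * ((q.eval x : ℝ) : ℂ) * (((q.eval x : ℝ) : ℂ) /
      (((q.eval x : ℝ) : ℂ) ^ 2 + (l : ℂ) ^ 2)) * ((φ x : ℝ) : ℂ)) * hI
  change ‖∫ x, V x * ((q.eval x ^ 2 / (q.eval x ^ 2 + l ^ 2) : ℝ) : ℂ) ∂(gaussianReal 0 1)‖ ≤ _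
  rw [hrew, norm_mul, Complex.norm_I, one_mul]
  calc ‖∫ x, V x * ((w' x : ℝ) : ℂ)‖ ≤ ∫ x, B x := by
        refine norm_integral_le_of_norm_le hBi (ae_of_all _ fun x => ?_)
        rw [norm_mul, hVn, one_mul, Complex.norm_real]
        exact hw'B x
    _ = (∫ x, |q.derivative.eval x / (q.eval x ^ 2 + l ^ 2)|) + 1 / (2 * l) * A := by
        rw [hB, integral_add hi1.abs (integrable_id_mul_gaussianPDFReal.abs.const_mul _),
          integral_const_mul]
    _ ≤ (n + 1) * Real.pi / l + 1 / (2 * l) * A := by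
        have hp' : (q.natDegree : ℝ) ≤ n := by exact_mod_cast hp
        have := Real.pi_pos
        gcongr
        refine hi2.trans ?_
        gcongr
    _ = ((n + 1) * Real.pi + A / 2) / l := by
        field_simp

/-! ### Oscillatory integrals in one variable -/

lemma enorm_rpow_neg_eq_ofReal {c : ℝ} (hc : c ≠ 0) (s : ℝ) :
    ‖c‖ₑ ^ (-s) = ENNReal.ofReal (|c| ^ (-s)) := by
  rw [Real.enorm_eq_ofReal_abs, ENNReal.ofReal_rpow_of_pos (abs_pos.2 hc)]

lemma enorm_integral_exp_le_one {α : Type*} [MeasurableSpace α] (μ : Measure α)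
    [IsProbabilityMeasure μ] (g : α → ℝ) :
    ‖∫ x, Complex.exp (Complex.I * ((g x : ℝ) : ℂ)) ∂μ‖ₑ ≤ 1 := by
  refine (enorm_integral_le_lintegral_enorm _).trans ?_
  have : ∀ x, ‖Complex.exp (Complex.I * ((g x : ℝ) : ℂ))‖ₑ = 1 := by
    intro x
    rw [← ofReal_norm, norm_exp_I_mul_ofReal, ENNReal.ofReal_one]
  simp [this]

lemma norm_integral_exp_linear_le (b c : ℝ) (hb : b ≠ 0) :
    ‖∫ x, Complex.exp (Complex.I * ((b * x + c : ℝ) : ℂ)) ∂(gaussianReal 0 1)‖ ≤ 1 / |b| := by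
  have h1 : ∫ x, Complex.exp (Complex.I * ((b * x + c : ℝ) : ℂ)) ∂(gaussianReal 0 1) =
      Complex.exp (Complex.I * (c : ℂ)) * charFun (gaussianReal 0 1) b := by
    rw [charFun_apply_real, ← integral_const_mul]
    congr 1 with x
    rw [← Complex.exp_add]
    congr 1
    push_cast
    ring
  have h2 : charFun (gaussianReal 0 1) b = ((Real.exp (-(b ^ 2 / 2)) : ℝ) : ℂ) := by
    rw [charFun_gaussianReal]
    push_cast
    congr 1
    simp
  rw [h1, norm_mul, norm_exp_I_mul_ofReal, one_mul, h2, Complex.norm_real, Real.norm_eq_abs,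
    abs_of_pos (Real.exp_pos _), Real.exp_neg, ← one_div]
  gcongr
  have := Real.add_one_le_exp (b ^ 2 / 2)
  nlinarith [sq_nonneg (|b| - 1), sq_abs b]

/-- The left side is at most `min 1 ((l / |y|) ^ 2)`, which lies below every intermediate power of
`l / |y|`. -/
lemma sq_div_sq_add_sq_le_rpow {l y η : ℝ} (hl : 0 < l) (hy : y ≠ 0) (h0 : 0 ≤ η)
    (h2 : η ≤ 2) : l ^ 2 / (y ^ 2 + l ^ 2) ≤ l ^ η * |y| ^ (-η) := by
  have hy' : 0 < |y| := abs_pos.2 hy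
  rw [Real.rpow_neg hy'.le, ← div_eq_mul_inv, ← Real.div_rpow hl.le hy'.le]
  rcases le_or_gt |y| l with h | h
  · calc l ^ 2 / (y ^ 2 + l ^ 2) ≤ 1 := by
          rw [div_le_one (by positivity)]
          nlinarith [sq_nonneg y]
      _ ≤ (l / |y|) ^ η := Real.one_le_rpow ((one_le_div hy').2 h) h0
  · calc l ^ 2 / (y ^ 2 + l ^ 2) ≤ (l / |y|) ^ (2 : ℝ) := by
          rw [Real.rpow_two, div_pow, sq_abs]
          gcongr
          nlinarith [sq_nonneg l]
      _ ≤ (l / |y|) ^ η :=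
        Real.rpow_le_rpow_of_exponent_ge (by positivity) ((div_le_one hy').2 h.le) h2

/-- The oscillatory integral of a polynomial of degree at most `n + 1` in one Gaussian variable,
when the coefficient under consideration is not small. -/
lemma exists_enorm_integral_exp_eval_le_of_one_le (n : ℕ) (hn : n ≠ 0) :
    ∃ K : ℝ, 1 ≤ K ∧ ∀ θ : ℝ, 0 < θ → θ < 1 → ∀ (p : Polynomial ℝ) (j : ℕ),
      p.natDegree ≤ n + 1 → 1 ≤ |p.coeff (j + 1)| →
      ‖∫ x, Complex.exp (Complex.I * ((p.eval x : ℝ) : ℂ)) ∂(gaussianReal 0 1)‖ₑ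
        ≤ ENNReal.ofReal (K / (1 - θ) * |p.coeff (j + 1)| ^ (-(θ / (n + 1)))) := by
  obtain ⟨K₁, hK₁, hmom⟩ := exists_lintegral_eval_rpow_neg_le n hn
  obtain ⟨K₂, hK₂, hparts⟩ := exists_norm_integral_large_deriv_le n
  refine ⟨K₁ + K₂, by linarith, fun θ h0 h1 p j hp hb => ?_⟩
  have h1' : 0 < 1 - θ := by linarith
  have hn' : (0 : ℝ) < n := by positivity
  set b := |p.coeff (j + 1)| with hbdef
  have hb0 : 0 < b := by linarith
  set q := p.derivative with hq
  have hqn : q.natDegree ≤ n := (Polynomial.natDegree_derivative_le p).trans (by omega)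
  set η : ℝ := θ / n with hη
  have hη0 : 0 < η := by positivity
  have hη2 : η ≤ 2 := by
    rw [hη, div_le_iff₀ hn']
    have : (1 : ℝ) ≤ n := by exact_mod_cast Nat.one_le_iff_ne_zero.2 hn
    linarith
  -- With `η = θ / n`, this `l` makes the moment part `(l / b) ^ η` equal to `b ^ (-(θ / (n + 1)))`;
  -- the part by parts, `1 / l`, is no larger in order because `b ≥ 1`.
  set l : ℝ := b ^ (1 / ((n : ℝ) + 1)) with hl
  have hl0 : 0 < l := Real.rpow_pos_of_pos hb0 _
  have hqc : |q.coeff j| = b * (j + 1) := by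
    rw [hq, Polynomial.coeff_derivative, abs_mul, abs_of_nonneg (by positivity : (0 : ℝ) ≤ j + 1)]
  have hqb : b ≤ |q.coeff j| := by
    rw [hqc]
    have : (0 : ℝ) ≤ j := Nat.cast_nonneg j
    nlinarith
  have hqne : q.coeff j ≠ 0 := abs_pos.1 (hb0.trans_le hqb)
  set V : ℝ → ℂ := fun x => Complex.exp (Complex.I * ((p.eval x : ℝ) : ℂ)) with hV
  have hVn : ∀ x, ‖V x‖ = 1 := fun x => norm_exp_I_mul_ofReal _
  have hpc : Continuous fun x => p.eval x := p.continuous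
  have hqc' : Continuous fun x => q.eval x := q.continuous
  have hVc : Continuous V := by fun_prop
  have hpos : ∀ x, 0 < q.eval x ^ 2 + l ^ 2 := fun x => by positivity
  have hint : ∀ g : ℝ → ℝ, Continuous g → (∀ x, 0 ≤ g x) → (∀ x, g x ≤ 1) →
      Integrable (fun x => V x * ((g x : ℝ) : ℂ)) (gaussianReal 0 1) := by
    intro g hg hg0 hg1
    refine (integrable_const (1 : ℝ)).mono' (by fun_prop) (ae_of_all _ fun x => ?_)
    rw [norm_mul, hVn, one_mul, Complex.norm_real, Real.norm_eq_abs, abs_of_nonneg (hg0 x)]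
    exact hg1 x
  have hsplit : ∫ x, V x ∂(gaussianReal 0 1) =
      (∫ x, V x * ((l ^ 2 / (q.eval x ^ 2 + l ^ 2) : ℝ) : ℂ) ∂(gaussianReal 0 1)) +
      ∫ x, V x * ((q.eval x ^ 2 / (q.eval x ^ 2 + l ^ 2) : ℝ) : ℂ) ∂(gaussianReal 0 1) := by
    rw [← integral_add]
    · congr 1 with x
      rw [← mul_add, ← Complex.ofReal_add, ← add_div, add_comm, div_self (hpos x).ne',
        Complex.ofReal_one, mul_one]
    · refine hint _ (continuous_const.div₀ (by fun_prop) fun x => (hpos x).ne')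
        (fun x => by positivity) fun x => ?_
      rw [div_le_one (hpos x)]
      nlinarith [sq_nonneg (q.eval x)]
    · refine hint _ (Continuous.div₀ (by fun_prop) (by fun_prop) fun x => (hpos x).ne')
        (fun x => by positivity) fun x => ?_
      rw [div_le_one (hpos x)]
      nlinarith [sq_nonneg l]
  have hfirst : ‖∫ x, V x * ((l ^ 2 / (q.eval x ^ 2 + l ^ 2) : ℝ) : ℂ) ∂(gaussianReal 0 1)‖ₑ ≤
      ENNReal.ofReal (K₁ / (1 - θ) * b ^ (-(θ / (n + 1)))) := by
    refine (enorm_integral_le_lintegral_enorm _).trans ?_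
    calc ∫⁻ x, ‖V x * ((l ^ 2 / (q.eval x ^ 2 + l ^ 2) : ℝ) : ℂ)‖ₑ ∂(gaussianReal 0 1)
        ≤ ∫⁻ x, ENNReal.ofReal (l ^ η) * ‖q.eval x‖ₑ ^ (-η) ∂(gaussianReal 0 1) := by
          refine lintegral_mono fun x => ?_
          rw [← ofReal_norm, norm_mul, hVn, one_mul, Complex.norm_real,
            Real.norm_eq_abs, abs_of_nonneg (by positivity)]
          by_cases hx : q.eval x = 0
          · rw [hx, enorm_zero, ENNReal.zero_rpow_of_neg (by linarith), ENNReal.mul_top]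
            · exact le_top
            · simp only [ne_eq, ENNReal.ofReal_eq_zero, not_le]
              positivity
          · rw [enorm_rpow_neg_eq_ofReal hx, ← ENNReal.ofReal_mul (by positivity)]
            exact ENNReal.ofReal_le_ofReal (sq_div_sq_add_sq_le_rpow hl0 hx hη0.le hη2)
      _ = ENNReal.ofReal (l ^ η) * ∫⁻ x, ‖q.eval x‖ₑ ^ (-η) ∂(gaussianReal 0 1) :=
          lintegral_const_mul _ (hqc'.measurable.enorm.pow_const _)
      _ ≤ ENNReal.ofReal (l ^ η) *
            (ENNReal.ofReal (K₁ / (1 - θ)) * ENNReal.ofReal (|q.coeff j| ^ (-η))) := by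
          rw [← enorm_rpow_neg_eq_ofReal hqne]
          gcongr
          exact hmom θ h0 h1 q j hqn
      _ = ENNReal.ofReal (l ^ η * (K₁ / (1 - θ) * |q.coeff j| ^ (-η))) := by
          rw [← ENNReal.ofReal_mul (by positivity), ← ENNReal.ofReal_mul (by positivity)]
      _ ≤ _ := by
          apply ENNReal.ofReal_le_ofReal
          calc l ^ η * (K₁ / (1 - θ) * |q.coeff j| ^ (-η))
              ≤ l ^ η * (K₁ / (1 - θ) * b ^ (-η)) := by
                have := Real.rpow_le_rpow_of_nonpos hb0 hqb (by linarith : -η ≤ 0)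
                gcongr
            _ = K₁ / (1 - θ) * (l ^ η * b ^ (-η)) := by ring
            _ = _ := by
                rw [hl, ← Real.rpow_mul hb0.le, ← Real.rpow_add hb0]
                congr 2
                rw [hη]
                field_simp
                ring
  have hsecond : ‖∫ x, V x * ((q.eval x ^ 2 / (q.eval x ^ 2 + l ^ 2) : ℝ) : ℂ)
      ∂(gaussianReal 0 1)‖ₑ ≤ ENNReal.ofReal (K₂ / (1 - θ) * b ^ (-(θ / (n + 1)))) := by
    rw [← ofReal_norm]
    apply ENNReal.ofReal_le_ofReal
    refine (hparts p hqn l hl0).trans ?_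
    rw [div_eq_mul_inv, hl, ← Real.rpow_neg hb0.le]
    gcongr
    · rw [le_div_iff₀ h1']
      nlinarith
  rw [hsplit]
  refine (enorm_add_le _ _).trans ((add_le_add hfirst hsecond).trans ?_)
  rw [← ENNReal.ofReal_add (by positivity) (by positivity), add_div, add_mul]

/-- Decay of the oscillatory integral of a polynomial in one Gaussian variable, in terms of any of
its nonconstant coefficients. -/
lemma exists_enorm_integral_exp_eval_le (m : ℕ) (hm : m ≠ 0) :
    ∃ K : ℝ, 1 ≤ K ∧ ∀ θ : ℝ, 0 < θ → θ < 1 → ∀ (p : Polynomial ℝ) (j : ℕ), j ≠ 0 →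
      p.natDegree ≤ m →
      ‖∫ x, Complex.exp (Complex.I * ((p.eval x : ℝ) : ℂ)) ∂(gaussianReal 0 1)‖ₑ
        ≤ ENNReal.ofReal (K / (1 - θ)) * ‖p.coeff j‖ₑ ^ (-(θ / m)) := by
  -- For a coefficient below 1 in absolute value the right side is at least 1, so the trivial bound
  -- on the integral suffices.
  suffices h : ∃ K : ℝ, 1 ≤ K ∧ ∀ θ : ℝ, 0 < θ → θ < 1 → ∀ (p : Polynomial ℝ) (j : ℕ),
      p.natDegree ≤ m → 1 ≤ |p.coeff (j + 1)| →
      ‖∫ x, Complex.exp (Complex.I * ((p.eval x : ℝ) : ℂ)) ∂(gaussianReal 0 1)‖ₑ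
        ≤ ENNReal.ofReal (K / (1 - θ) * |p.coeff (j + 1)| ^ (-(θ / m))) by
    obtain ⟨K, hK, h⟩ := h
    refine ⟨K, hK, fun θ h0 h1 p j hj hp => ?_⟩
    obtain ⟨i, rfl⟩ := Nat.exists_eq_succ_of_ne_zero hj
    have h1' : 0 < 1 - θ := by linarith
    have hK' : 1 ≤ K / (1 - θ) := by
      rw [le_div_iff₀ h1']
      linarith
    have hs : 0 < θ / m := by positivity
    rcases le_or_gt 1 |p.coeff (i + 1)| with hb | hb
    · refine (h θ h0 h1 p i hp hb).trans_eq ?_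
      rw [ENNReal.ofReal_mul (by positivity), enorm_rpow_neg_eq_ofReal]
      exact abs_pos.1 (by linarith)
    · refine (enorm_integral_exp_le_one _ _).trans ?_
      refine one_le_mul (ENNReal.one_le_ofReal.2 hK') ?_
      by_cases hc : p.coeff (i + 1) = 0
      · rw [hc, enorm_zero, ENNReal.zero_rpow_of_neg (by linarith)]
        exact le_top
      · refine ENNReal.one_le_rpow_of_pos_of_le_one_of_neg (enorm_pos.2 hc) ?_ (by linarith)
        rw [Real.enorm_eq_ofReal_abs]
        exact ENNReal.ofReal_le_one.2 hb.le
  rcases Nat.exists_eq_succ_of_ne_zero hm with ⟨n, rfl⟩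
  rcases Nat.eq_zero_or_pos n with rfl | hn
  -- For `m = 1` the derivative is constant and `θ / n` would have `n = 0`; the Gaussian
  -- characteristic function gives the decay directly.
  · refine ⟨1, le_rfl, fun θ h0 h1 p j hp hb => ?_⟩
    have h1' : 0 < 1 - θ := by linarith
    have hj : j = 0 := by
      by_contra hj
      rw [Polynomial.coeff_eq_zero_of_natDegree_lt (by omega), abs_zero] at hb
      linarith
    subst hj
    have hne : p.coeff (0 + 1) ≠ 0 := abs_pos.1 (by linarith)
    have hpe : ∀ x, p.eval x = p.coeff (0 + 1) * x + p.coeff 0 := by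
      intro x
      rw [Polynomial.eval_eq_sum_range' (n := 2) (by omega), Finset.sum_range_succ,
        Finset.sum_range_one]
      simp
      ring
    simp only [hpe]
    rw [← ofReal_norm]
    apply ENNReal.ofReal_le_ofReal
    refine (norm_integral_exp_linear_le _ _ hne).trans ?_
    rw [one_div, ← Real.rpow_neg_one]
    calc |p.coeff (0 + 1)| ^ (-1 : ℝ) ≤ |p.coeff (0 + 1)| ^ (-(θ / (Nat.succ 0 : ℕ))) := by
          apply Real.rpow_le_rpow_of_exponent_le hb
          simp
          exact h1.le
      _ ≤ _ := by
          apply le_mul_of_one_le_left (by positivity)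
          rw [le_div_iff₀ h1']
          linarith
  · obtain ⟨K, hK, h⟩ := exists_enorm_integral_exp_eval_le_of_one_le n hn.ne'
    refine ⟨K, hK, fun θ h0 h1 p j hp hb => ?_⟩
    simpa using h θ h0 h1 p j hp hb

/-! ### Several variables, by induction on their number -/

lemma lintegral_pi_succ (μ : Measure ℝ) [SigmaFinite μ] {n : ℕ} {F : (Fin (n + 1) → ℝ) → ENNReal}
    (hF : Measurable F) :
    ∫⁻ z, F z ∂(Measure.pi fun _ => μ) =
      ∫⁻ y, ∫⁻ x, F (Fin.cons x y) ∂μ ∂(Measure.pi fun _ : Fin n => μ) := by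
  have hmp := (measurePreserving_piFinSuccAbove (fun _ : Fin (n + 1) => μ) 0).symm
  have he : ∀ w, (MeasurableEquiv.piFinSuccAbove (fun _ : Fin (n + 1) => ℝ) 0).symm w =
      Fin.cons w.1 w.2 := fun w => Fin.insertNth_zero' w.1 w.2
  rw [← hmp.lintegral_comp hF]
  have hm := hF.comp (MeasurableEquiv.piFinSuccAbove (fun _ : Fin (n + 1) => ℝ) 0).symm.measurable
  simp only [Function.comp_def, he] at hm
  simp only [he]
  exact lintegral_prod_symm' _ hm

lemma integral_pi_succ (μ : Measure ℝ) [SigmaFinite μ] {n : ℕ} (F : (Fin (n + 1) → ℝ) → ℂ) :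
    ∫ z, F z ∂(Measure.pi fun _ => μ) =
      ∫ w : ℝ × (Fin n → ℝ), F (Fin.cons w.1 w.2) ∂(μ.prod (Measure.pi fun _ : Fin n => μ)) := by
  have hmp := (measurePreserving_piFinSuccAbove (fun _ : Fin (n + 1) => μ) 0).symm
  have he : ∀ w, (MeasurableEquiv.piFinSuccAbove (fun _ : Fin (n + 1) => ℝ) 0).symm w =
      Fin.cons w.1 w.2 := fun w => Fin.insertNth_zero' w.1 w.2
  rw [← hmp.integral_comp']
  simp only [he]

lemma measurable_eval_mvPolynomial {n : ℕ} (f : MvPolynomial (Fin n) ℝ) :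
    Measurable fun y : Fin n → ℝ => MvPolynomial.eval y f :=
  (MvPolynomial.continuous_eval f).measurable

lemma natDegree_map_finSuccEquiv_le {n m : ℕ} {f : MvPolynomial (Fin (n + 1)) ℝ}
    (hf : ∀ i, f.degreeOf i ≤ m) (y : Fin n → ℝ) :
    ((MvPolynomial.finSuccEquiv ℝ n f).map (MvPolynomial.eval y)).natDegree ≤ m :=
  Polynomial.natDegree_map_le.trans ((MvPolynomial.natDegree_finSuccEquiv f).le.trans (hf 0))

/-- Negative moments of a polynomial in several independent Gaussian variables. -/
lemma lintegral_pi_eval_rpow_neg_le {m : ℕ} {s : ℝ} {A : ENNReal}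
    (h : ∀ (q : Polynomial ℝ) (j : ℕ), q.natDegree ≤ m →
      ∫⁻ x, ‖q.eval x‖ₑ ^ (-s) ∂(gaussianReal 0 1) ≤ A * ‖q.coeff j‖ₑ ^ (-s)) :
    ∀ (n : ℕ) (f : MvPolynomial (Fin n) ℝ) (d : Fin n →₀ ℕ), (∀ i, f.degreeOf i ≤ m) →
      ∫⁻ y, ‖MvPolynomial.eval y f‖ₑ ^ (-s) ∂(Measure.pi fun _ => gaussianReal 0 1)
        ≤ A ^ n * ‖f.coeff d‖ₑ ^ (-s) := by
  intro n
  induction n with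
  | zero =>
    intro f d _
    obtain ⟨c, rfl⟩ := MvPolynomial.C_surjective (Fin 0) f
    rw [Subsingleton.elim d 0]
    simp
  | succ n ih =>
    intro f d hf
    rw [lintegral_pi_succ _ ((measurable_eval_mvPolynomial f).enorm.pow_const _)]
    simp only [MvPolynomial.eval_eq_eval_mv_eval']
    set F := MvPolynomial.finSuccEquiv ℝ n f with hF
    calc _ ≤ ∫⁻ y, A * ‖MvPolynomial.eval y (F.coeff (d 0))‖ₑ ^ (-s)
          ∂(Measure.pi fun _ => gaussianReal 0 1) := by
          refine lintegral_mono fun y => ?_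
          refine (h _ (d 0) (natDegree_map_finSuccEquiv_le hf y)).trans_eq ?_
          rw [Polynomial.coeff_map]
      _ = A * ∫⁻ y, ‖MvPolynomial.eval y (F.coeff (d 0))‖ₑ ^ (-s)
          ∂(Measure.pi fun _ => gaussianReal 0 1) :=
          lintegral_const_mul _ ((measurable_eval_mvPolynomial _).enorm.pow_const _)
      _ ≤ A * (A ^ n * ‖(F.coeff (d 0)).coeff d.tail‖ₑ ^ (-s)) := by
          gcongr
          exact ih _ _ fun i => (MvPolynomial.degreeOf_coeff_finSuccEquiv f i (d 0)).trans (hf _)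
      _ = _ := by
          rw [hF, MvPolynomial.finSuccEquiv_coeff_coeff, Finsupp.cons_tail, pow_succ']
          ring

/-- The coefficient of a fixed monomial in the last variables, as a polynomial in the first
variable. -/
lemma exists_polynomial_eval_eq_coeff {n m : ℕ} {f : MvPolynomial (Fin (n + 1)) ℝ}
    (hf : ∀ i, f.degreeOf i ≤ m) (e : Fin n →₀ ℕ) :
    ∃ q : Polynomial ℝ, q.natDegree ≤ m ∧ (∀ i, q.coeff i = f.coeff (e.cons i)) ∧
      ∀ x, q.eval x =
        ((MvPolynomial.finSuccEquiv ℝ n f).eval (MvPolynomial.C x)).coeff e := by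
  set F := MvPolynomial.finSuccEquiv ℝ n f with hF
  have hFm : F.natDegree < m + 1 :=
    Nat.lt_succ_of_le ((MvPolynomial.natDegree_finSuccEquiv f).le.trans (hf 0))
  refine ⟨∑ i ∈ Finset.range (m + 1), Polynomial.monomial i ((F.coeff i).coeff e), ?_, ?_, ?_⟩
  · refine Polynomial.natDegree_sum_le_of_forall_le _ _ fun i hi => ?_
    exact (Polynomial.natDegree_monomial_le _).trans (Nat.lt_succ_iff.1 (Finset.mem_range.1 hi))
  · intro i
    rw [← MvPolynomial.finSuccEquiv_coeff_coeff, ← hF, Polynomial.finsetSum_coeff]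
    simp only [Polynomial.coeff_monomial, Finset.sum_ite_eq', Finset.mem_range]
    split_ifs with hi
    · rfl
    · rw [Polynomial.coeff_eq_zero_of_natDegree_lt (by omega), MvPolynomial.coeff_zero]
  · intro x
    rw [Polynomial.eval_eq_sum_range' hFm, MvPolynomial.coeff_sum, Polynomial.eval_finsetSum]
    refine Finset.sum_congr rfl fun i _ => ?_
    rw [Polynomial.eval_monomial, ← map_pow, mul_comm, mul_comm (F.coeff i),
      MvPolynomial.coeff_C_mul]

lemma eval_eval_C_finSuccEquiv {n : ℕ} (f : MvPolynomial (Fin (n + 1)) ℝ) (x : ℝ)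
    (y : Fin n → ℝ) :
    MvPolynomial.eval y ((MvPolynomial.finSuccEquiv ℝ n f).eval (MvPolynomial.C x)) =
      MvPolynomial.eval (Fin.cons x y : Fin (n + 1) → ℝ) f := by
  rw [MvPolynomial.eval_eq_eval_mv_eval', Polynomial.eval_map, Polynomial.eval,
    Polynomial.hom_eval₂]
  simp

lemma degreeOf_eval_C_finSuccEquiv_le {n m : ℕ} {f : MvPolynomial (Fin (n + 1)) ℝ}
    (hf : ∀ i, f.degreeOf i ≤ m) (x : ℝ) (i : Fin n) :
    ((MvPolynomial.finSuccEquiv ℝ n f).eval (MvPolynomial.C x)).degreeOf i ≤ m := by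
  rw [Polynomial.eval_eq_sum_range]
  refine (MvPolynomial.degreeOf_sum_le _ _ _).trans (Finset.sup_le fun j _ => ?_)
  rw [← map_pow, mul_comm]
  exact (MvPolynomial.degreeOf_C_mul_le _ _ _).trans
    ((MvPolynomial.degreeOf_coeff_finSuccEquiv f i j).trans (hf _))

/-- Decay of the oscillatory integral of a polynomial in several independent Gaussian variables,
in terms of any of its nonconstant coefficients. -/
lemma enorm_integral_pi_exp_eval_le {m : ℕ} {s : ℝ} {A : ENNReal}
    (hmom : ∀ (q : Polynomial ℝ) (j : ℕ), q.natDegree ≤ m →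
      ∫⁻ x, ‖q.eval x‖ₑ ^ (-s) ∂(gaussianReal 0 1) ≤ A * ‖q.coeff j‖ₑ ^ (-s))
    (hosc : ∀ (p : Polynomial ℝ) (j : ℕ), j ≠ 0 → p.natDegree ≤ m →
      ‖∫ x, Complex.exp (Complex.I * ((p.eval x : ℝ) : ℂ)) ∂(gaussianReal 0 1)‖ₑ
        ≤ A * ‖p.coeff j‖ₑ ^ (-s)) :
    ∀ (n : ℕ) (f : MvPolynomial (Fin n) ℝ) (d : Fin n →₀ ℕ), d ≠ 0 →
      (∀ i, f.degreeOf i ≤ m) →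
      ‖∫ y, Complex.exp (Complex.I * ((MvPolynomial.eval y f : ℝ) : ℂ))
        ∂(Measure.pi fun _ => gaussianReal 0 1)‖ₑ ≤ A ^ n * ‖f.coeff d‖ₑ ^ (-s) := by
  intro n
  induction n with
  | zero =>
    intro f d hd
    exact absurd (Subsingleton.elim d 0) hd
  | succ n ih =>
    intro f d hd hf
    rw [integral_pi_succ]
    have hint : Integrable (fun w : ℝ × (Fin n → ℝ) => Complex.exp (Complex.I *
        ((MvPolynomial.eval (Fin.cons w.1 w.2 : Fin (n + 1) → ℝ) f : ℝ) : ℂ)))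
        ((gaussianReal 0 1).prod (Measure.pi fun _ => gaussianReal 0 1)) := by
      refine (integrable_const (1 : ℝ)).mono' ?_
        (ae_of_all _ fun w => (norm_exp_I_mul_ofReal _).le)
      apply Continuous.aestronglyMeasurable
      have h1 : Continuous fun w : ℝ × (Fin n → ℝ) => (Fin.cons w.1 w.2 : Fin (n + 1) → ℝ) := by
        refine continuous_pi fun i => ?_
        refine Fin.cases ?_ (fun j => ?_) i
        · simpa using continuous_fst
        · simpa using! (continuous_apply j).comp continuous_snd
      have h2 := (MvPolynomial.continuous_eval f).comp h1
      exact (continuous_const.mul (Complex.continuous_ofReal.comp h2)).cexp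
    -- If the monomial involves only the first variable, the oscillation is used there, and its
    -- coefficient, a polynomial in the other variables, is handled by negative moments.
    by_cases ht : d.tail = 0
    · have hd0 : d 0 ≠ 0 := by
        intro h0
        apply hd
        rw [← Finsupp.cons_tail d, h0, ht, Finsupp.cons_zero_zero]
      rw [integral_prod_symm _ hint]
      refine (enorm_integral_le_lintegral_enorm _).trans ?_
      simp only [MvPolynomial.eval_eq_eval_mv_eval']
      set F := MvPolynomial.finSuccEquiv ℝ n f with hF
      calc _ ≤ ∫⁻ y, A * ‖MvPolynomial.eval y (F.coeff (d 0))‖ₑ ^ (-s)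
            ∂(Measure.pi fun _ => gaussianReal 0 1) := by
            refine lintegral_mono fun y => ?_
            refine (hosc _ (d 0) hd0 (natDegree_map_finSuccEquiv_le hf y)).trans_eq ?_
            rw [Polynomial.coeff_map]
        _ = A * ∫⁻ y, ‖MvPolynomial.eval y (F.coeff (d 0))‖ₑ ^ (-s)
            ∂(Measure.pi fun _ => gaussianReal 0 1) :=
            lintegral_const_mul _ ((measurable_eval_mvPolynomial _).enorm.pow_const _)
        _ ≤ A * (A ^ n * ‖(F.coeff (d 0)).coeff d.tail‖ₑ ^ (-s)) := by
            gcongr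
            exact lintegral_pi_eval_rpow_neg_le hmom n _ _ fun i =>
              (MvPolynomial.degreeOf_coeff_finSuccEquiv f i (d 0)).trans (hf _)
        _ = _ := by
            rw [hF, MvPolynomial.finSuccEquiv_coeff_coeff, Finsupp.cons_tail, pow_succ']
            ring
    -- Otherwise the first variable is frozen and the oscillation comes from the others by
    -- induction; the coefficient of their monomial is a polynomial in `x`, handled by `hmom`.
    · rw [integral_prod _ hint]
      refine (enorm_integral_le_lintegral_enorm _).trans ?_
      simp only [← eval_eval_C_finSuccEquiv]
      obtain ⟨q, hqm, hqc, hqe⟩ := exists_polynomial_eval_eq_coeff hf d.tail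
      calc _ ≤ ∫⁻ x, A ^ n * ‖q.eval x‖ₑ ^ (-s) ∂(gaussianReal 0 1) := by
            refine lintegral_mono fun x => ?_
            rw [hqe]
            exact ih _ _ ht (degreeOf_eval_C_finSuccEquiv_le hf x)
        _ = A ^ n * ∫⁻ x, ‖q.eval x‖ₑ ^ (-s) ∂(gaussianReal 0 1) :=
            lintegral_const_mul _ (q.continuous.measurable.enorm.pow_const _)
        _ ≤ A ^ n * (A * ‖q.coeff (d 0)‖ₑ ^ (-s)) := by
            gcongr
            exact hmom q (d 0) hqm
        _ = _ := by
            rw [hqc, Finsupp.cons_tail, pow_succ]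
            ring

/-! ### Invariance under shifts -/

/-- The polynomial `f(x + a)`. -/
noncomputable def shiftPoly {k : ℕ} (a : Fin k → ℝ) :
    MvPolynomial (Fin k) ℝ →ₐ[ℝ] MvPolynomial (Fin k) ℝ :=
  MvPolynomial.aeval fun i => MvPolynomial.X i + MvPolynomial.C (a i)

lemma eval_shiftPoly {k : ℕ} (a z : Fin k → ℝ) (f : MvPolynomial (Fin k) ℝ) :
    MvPolynomial.eval z (shiftPoly a f) = MvPolynomial.eval (fun i => z i + a i) f := by
  have h : (MvPolynomial.aeval z).comp (shiftPoly a) =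
      MvPolynomial.aeval (R := ℝ) (fun i => z i + a i) := by
    ext i
    simp [shiftPoly]
  simpa [MvPolynomial.aeval_eq_eval] using DFunLike.congr_fun h f

/-- A shift does not change the coefficients of top degree. -/
lemma coeff_shiftPoly_monomial {k : ℕ} (a : Fin k → ℝ) (e : Fin k →₀ ℕ) :
    ∀ d : Fin k →₀ ℕ, e.degree ≤ d.degree →
      (shiftPoly a (MvPolynomial.monomial e 1)).coeff d =
        (MvPolynomial.monomial e (1 : ℝ)).coeff d := by
  classical
  obtain ⟨N, hN⟩ : ∃ N, e.degree = N := ⟨_, rfl⟩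
  induction N generalizing e with
  | zero =>
    intro d _
    obtain rfl := (Finsupp.degree_eq_zero_iff e).1 hN
    have : MvPolynomial.monomial (0 : Fin k →₀ ℕ) (1 : ℝ) = 1 := rfl
    rw [this, map_one]
  | succ N ih =>
    intro d hd
    obtain ⟨i, hi⟩ := Finsupp.support_nonempty_iff.2
      (fun h => by rw [h, map_zero] at hN; omega : e ≠ 0)
    obtain ⟨e, rfl⟩ : ∃ e', e = e' + Finsupp.single i 1 :=
      ⟨e - Finsupp.single i 1, (tsub_add_cancel_of_le (Finsupp.single_le_iff.2
        (Nat.one_le_iff_ne_zero.2 (Finsupp.mem_support_iff.1 hi)))).symm⟩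
    rw [map_add, Finsupp.degree_single] at hd hN
    replace ih := ih e (by omega)
    have hmon : MvPolynomial.monomial (e + Finsupp.single i 1) (1 : ℝ) =
        MvPolynomial.X i * MvPolynomial.monomial e 1 := by
      rw [MvPolynomial.X, MvPolynomial.monomial_mul, one_mul, add_comm]
    have hX : shiftPoly a (MvPolynomial.X i) = MvPolynomial.X i + MvPolynomial.C (a i) := by
      simp [shiftPoly]
    -- The term multiplied by `a i` contributes nothing: its monomial `e` has degree smaller than
    -- that of `d`.
    rw [hmon, map_mul, hX, add_mul, MvPolynomial.coeff_add, MvPolynomial.coeff_C_mul,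
      ih d (by omega), MvPolynomial.coeff_monomial, if_neg (by rintro rfl; omega), mul_zero,
      add_zero, MvPolynomial.coeff_X_mul', MvPolynomial.coeff_X_mul']
    split_ifs with hi
    · apply ih
      have hle : Finsupp.single i 1 ≤ d := by
        rw [Finsupp.single_le_iff]
        exact Nat.one_le_iff_ne_zero.2 (Finsupp.mem_support_iff.1 hi)
      have := congrArg Finsupp.degree (tsub_add_cancel_of_le hle)
      rw [map_add, Finsupp.degree_single] at this
      omega
    · rfl

lemma coeff_shiftPoly {k : ℕ} (a : Fin k → ℝ) (f : MvPolynomial (Fin k) ℝ) (d : Fin k →₀ ℕ)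
    (hd : f.totalDegree ≤ d.degree) : (shiftPoly a f).coeff d = f.coeff d := by
  have hmon : ∀ e, MvPolynomial.monomial e (f.coeff e) =
      f.coeff e • MvPolynomial.monomial e (1 : ℝ) := by
    intro e
    rw [MvPolynomial.smul_monomial, smul_eq_mul, mul_one]
  conv_lhs => rw [f.as_sum]
  conv_rhs => rw [f.as_sum]
  rw [map_sum, MvPolynomial.coeff_sum, MvPolynomial.coeff_sum]
  refine Finset.sum_congr rfl fun e he => ?_
  rw [hmon, map_smul, MvPolynomial.coeff_smul, MvPolynomial.coeff_smul,
    coeff_shiftPoly_monomial a e d ((MvPolynomial.le_totalDegree he).trans hd)]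

/-- Each factor `X j + C (a j)` involves only the variable `j`, to degree one, so shifting a
monomial raises no partial degree. -/
lemma degreeOf_shiftPoly_le {k m : ℕ} (a : Fin k → ℝ) {f : MvPolynomial (Fin k) ℝ} (i : Fin k)
    (hf : f.degreeOf i ≤ m) : (shiftPoly a f).degreeOf i ≤ m := by
  rw [f.as_sum, map_sum]
  refine (MvPolynomial.degreeOf_sum_le _ _ _).trans (Finset.sup_le fun e he => ?_)
  rw [shiftPoly, MvPolynomial.aeval_monomial]
  refine (MvPolynomial.degreeOf_C_mul_le _ _ _).trans ?_
  rw [Finsupp.prod]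
  refine (MvPolynomial.degreeOf_prod_le _ _ _).trans ?_
  calc ∑ j ∈ e.support, ((MvPolynomial.X j + MvPolynomial.C (a j)) ^ e j :
        MvPolynomial (Fin k) ℝ).degreeOf i
      ≤ ∑ j ∈ e.support, if j = i then e j else 0 := by
        refine Finset.sum_le_sum fun j _ => (MvPolynomial.degreeOf_pow_le _ _ _).trans ?_
        have h1 := MvPolynomial.degreeOf_add_le i (MvPolynomial.X j : MvPolynomial (Fin k) ℝ)
          (MvPolynomial.C (a j))
        rw [MvPolynomial.degreeOf_X, MvPolynomial.degreeOf_C] at h1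
        split_ifs with hij
        · rw [if_pos hij.symm, max_eq_left zero_le_one] at h1
          exact (Nat.mul_le_mul_left _ h1).trans_eq (mul_one _)
        · rw [if_neg fun h => hij h.symm] at h1
          simp [Nat.le_zero.1 (h1.trans (by simp))]
    _ ≤ e i := by
        rw [Finset.sum_ite_eq']
        split_ifs <;> simp
    _ ≤ m := (MvPolynomial.monomial_le_degreeOf i he).trans hf

/-! ### The top coefficient, the choice of `θ`, and the conclusion -/

lemma exists_coeff_eq_maxTopCoeff {k : ℕ} (f : MvPolynomial (Fin k) ℝ) (hf : f ≠ 0) :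
    ∃ d : Fin k →₀ ℕ, d.degree = f.totalDegree ∧ f.coeff d ≠ 0 ∧
      |f.coeff d| = maxTopCoeff f := by
  have hne : (f.support.filter (fun d => d.degree = f.totalDegree)).Nonempty := by
    obtain ⟨d, hd, he⟩ := Finset.exists_mem_eq_sup f.support
      (MvPolynomial.support_nonempty.2 hf) (fun s => s.sum fun _ e => e)
    exact ⟨d, Finset.mem_filter.2 ⟨hd, he.symm⟩⟩
  obtain ⟨d, hd, he⟩ := Finset.exists_mem_eq_sup _ hne (fun d => ‖f.coeff d‖₊)
  rw [Finset.mem_filter] at hd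
  exact ⟨d, hd.2, MvPolynomial.mem_support_iff.1 hd.1, by
    rw [maxTopCoeff, he, coe_nnnorm, Real.norm_eq_abs]⟩

lemma absCharFun_eq {k : ℕ} {Ω : Type*} [MeasurableSpace Ω] (P : Measure Ω)
    [IsProbabilityMeasure P] (Z : Fin k → Ω → ℝ) (hind : iIndepFun Z P)
    (hlaw : ∀ i, HasLaw (Z i) (gaussianReal 0 1) P) (f : MvPolynomial (Fin k) ℝ) (t : ℝ)
    (a : Fin k → ℝ) :
    absCharFun P Z f t a = ‖∫ y, Complex.exp (Complex.I *
      ((MvPolynomial.eval y (MvPolynomial.C t * shiftPoly a f) : ℝ) : ℂ))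
        ∂(Measure.pi fun _ => gaussianReal 0 1)‖ := by
  have hZ := iIndepFun.hasLaw_pi hlaw hind
  rw [absCharFun, ← hZ.integral_comp]
  · congr 2 with ω
    simp only [Function.comp, map_mul, MvPolynomial.eval_C, eval_shiftPoly, Complex.ofReal_mul,
      mul_assoc]
  · apply Continuous.aestronglyMeasurable
    have := MvPolynomial.continuous_eval (MvPolynomial.C t * shiftPoly a f)
    fun_prop

/-- The choice of the exponent `θ` close to `1` that turns a loss of a power of `1 / (1 - θ)` into
a loss of a power of a logarithm. -/
lemma rpow_neg_div_le {m : ℕ} (hm : m ≠ 0) {s : ℝ} (hs : 1 ≤ s) :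
    s ^ (-((1 - Real.log 2 / Real.log (2 + s)) / m)) ≤ 2 * s ^ (-(1 / (m : ℝ))) := by
  have hm1 : (1 : ℝ) ≤ m := by exact_mod_cast Nat.one_le_iff_ne_zero.2 hm
  have hs0 : 0 < s := by linarith
  have hL : 0 < Real.log (2 + s) := Real.log_pos (by linarith)
  have hl2 : 0 < Real.log 2 := Real.log_pos (by norm_num)
  have e : -((1 - Real.log 2 / Real.log (2 + s)) / m) =
      Real.log 2 / Real.log (2 + s) / m + -(1 / (m : ℝ)) := by ring
  rw [e, Real.rpow_add hs0]
  gcongr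
  calc s ^ (Real.log 2 / Real.log (2 + s) / m)
      ≤ (2 + s) ^ (Real.log 2 / Real.log (2 + s) / m) := by
        apply Real.rpow_le_rpow hs0.le (by linarith)
        positivity
    _ ≤ (2 + s) ^ (Real.log 2 / Real.log (2 + s)) := by
        apply Real.rpow_le_rpow_of_exponent_le (by linarith)
        exact div_le_self (by positivity) hm1
    _ = 2 := by
        rw [Real.rpow_def_of_pos (by linarith), mul_div_cancel₀ _ hL.ne',
          Real.exp_log (by norm_num)]

theorem theorem3 (k M m : ℕ) (hM : 2 ≤ M) :
    ∃ c₇ c₈ : ℝ,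
      ∀ (Ω : Type*) [MeasurableSpace Ω] (P : Measure Ω) [IsProbabilityMeasure P]
        (Z : Fin k → Ω → ℝ),
        iIndepFun Z P → (∀ i, HasLaw (Z i) (gaussianReal 0 1) P) →
        ∀ f : MvPolynomial (Fin k) ℝ,
          (∀ i, f.degreeOf i ≤ m) → MvPolynomial.constantCoeff f = 0 → f.totalDegree = M →
          ∀ t : ℝ, t ≠ 0 →
            BddAbove (Set.range (fun a : Fin k → ℝ => absCharFun P Z f t a)) ∧
            (⨆ a : Fin k → ℝ, absCharFun P Z f t a) ≤
              c₇ * |maxTopCoeff f * t| ^ (-(1 / (m : ℝ))) *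
                Real.log (2 + |maxTopCoeff f * t|) ^ c₈ := by
  -- For `m = 0` only constants qualify, contradicting `M ≥ 2`.
  rcases eq_or_ne m 0 with rfl | hm
  · refine ⟨0, 0, fun Ω _ P _ Z _ _ f hf _ hfM => ?_⟩
    have hf0 : f ≠ 0 := by
      rintro rfl
      rw [MvPolynomial.totalDegree_zero] at hfM
      omega
    obtain ⟨d, hdM, hdc, -⟩ := exists_coeff_eq_maxTopCoeff f hf0
    have hd : d = 0 := by
      ext i
      exact Nat.le_zero.1 ((MvPolynomial.monomial_le_degreeOf i
        (MvPolynomial.mem_support_iff.2 hdc)).trans (hf i))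
    rw [hd, map_zero] at hdM
    omega
  obtain ⟨K₁, hK₁, hmom⟩ := exists_lintegral_eval_rpow_neg_le m hm
  obtain ⟨K₂, hK₂, hosc⟩ := exists_enorm_integral_exp_eval_le m hm
  set K := max K₁ K₂ with hK
  have hK1 : 1 ≤ K := hK₁.trans (le_max_left _ _)
  have hl2 : 0 < Real.log 2 := Real.log_pos (by norm_num)
  -- With `1 - θ = log 2 / log (2 + s)`, `(K / (1 - θ)) ^ k` equals `(K / log 2) ^ k * log (2 + s) ^
  -- k`; the 2 comes from `rpow_neg_div_le`.
  refine ⟨2 * (K / Real.log 2) ^ k, k, fun Ω _ P _ Z hind hlaw f hf _ hfM t ht => ?_⟩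
  have hf0 : f ≠ 0 := by
    rintro rfl
    rw [MvPolynomial.totalDegree_zero] at hfM
    omega
  obtain ⟨d, hdM, hdc, hdα⟩ := exists_coeff_eq_maxTopCoeff f hf0
  have hd0 : d ≠ 0 := by
    rintro rfl
    rw [map_zero] at hdM
    omega
  set s := |maxTopCoeff f * t| with hs
  have hs' : s = |t * f.coeff d| := by
    rw [hs, ← hdα, abs_mul, abs_abs, abs_mul, mul_comm]
  have hs0 : 0 < s := by
    rw [hs']
    exact abs_pos.2 (mul_ne_zero ht hdc)
  have hLpos : Real.log 2 ≤ Real.log (2 + s) := Real.log_le_log (by norm_num) (by linarith)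
  have hone : ∀ a, absCharFun P Z f t a ≤ 1 := by
    intro a
    rw [absCharFun_eq P Z hind hlaw]
    have := enorm_integral_exp_le_one (Measure.pi fun _ : Fin k => gaussianReal 0 1)
      (fun y => MvPolynomial.eval y (MvPolynomial.C t * shiftPoly a f))
    rw [← ofReal_norm] at this
    exact ENNReal.ofReal_le_one.1 this
  refine ⟨⟨1, by rintro _ ⟨a, rfl⟩; exact hone a⟩, ciSup_le fun a => ?_⟩
  rw [Real.rpow_natCast, mul_right_comm, mul_assoc 2, ← mul_pow, div_mul_eq_mul_div]
  rcases le_or_gt 1 s with h1s | h1s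
  · set θ : ℝ := 1 - Real.log 2 / Real.log (2 + s) with hθ
    have hL : Real.log 2 < Real.log (2 + s) := Real.log_lt_log (by norm_num) (by linarith)
    have hLp : 0 < Real.log (2 + s) := hl2.trans hL
    have hθ0 : 0 < θ := by
      rw [hθ, sub_pos, div_lt_one hLp]
      exact hL
    have hθ1 : 1 - θ = Real.log 2 / Real.log (2 + s) := by rw [hθ]; ring
    have hθ1' : 0 < 1 - θ := by rw [hθ1]; positivity
    have hθlt : θ < 1 := by linarith
    have hA : K / (1 - θ) = K * Real.log (2 + s) / Real.log 2 := by
      rw [hθ1, div_div_eq_mul_div]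
    have key := enorm_integral_pi_exp_eval_le (m := m) (s := θ / m)
      (A := ENNReal.ofReal (K / (1 - θ)))
      (fun q j hq => (hmom θ hθ0 hθlt q j hq).trans
        (by gcongr; exact le_max_left _ _))
      (fun p j hj hp => (hosc θ hθ0 hθlt p j hj hp).trans
        (by gcongr; exact le_max_right _ _))
      k (MvPolynomial.C t * shiftPoly a f) d hd0
      (fun i => (MvPolynomial.degreeOf_C_mul_le _ _ _).trans (degreeOf_shiftPoly_le a i (hf i)))
    have hcoeff : (MvPolynomial.C t * shiftPoly a f).coeff d = t * f.coeff d := by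
      rw [MvPolynomial.coeff_C_mul, coeff_shiftPoly a f d hdM.ge]
    rw [hcoeff, enorm_rpow_neg_eq_ofReal (mul_ne_zero ht hdc), ← hs', ← ofReal_norm,
      ← absCharFun_eq P Z hind hlaw, ← ENNReal.ofReal_pow (by positivity),
      ← ENNReal.ofReal_mul (by positivity), ENNReal.ofReal_le_ofReal_iff (by positivity),
      hA] at key
    refine key.trans ?_
    rw [mul_comm 2, mul_assoc]
    gcongr
    exact rpow_neg_div_le hm h1s
  -- For `s < 1` the right side is already at least 1, since `K ≥ 1` and `log (2 + s) ≥ log 2`.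
  · refine (hone a).trans ?_
    have e1 : 1 ≤ (K * Real.log (2 + s) / Real.log 2) ^ k := by
      apply one_le_pow₀
      rw [le_div_iff₀ hl2]
      nlinarith
    have e2 : 1 ≤ s ^ (-(1 / (m : ℝ))) := by
      apply Real.one_le_rpow_of_pos_of_le_one_of_nonpos hs0 h1s.le
      have : (0 : ℝ) ≤ 1 / m := by positivity
      linarith
    nlinarith
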